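/- **Theorem 3.3.** Let $n\ge 1$, let $\mathbf A\in\mathbb R^{m\times n}$ have full column rank, let $\mathbf b\in\mathbb R^m$, $0<\epsilon<1$, $0<\delta<1$, and let $s$ be an integer with $s\ge (n^2+n)/(\delta\epsilon^2)$. Let $\mathbf S=\Phi\mathbf D\in\mathbb R^{s\times m}$ be a count sketch matrix: $\mathbf D$ is diagonal with entries $\pm1$, each with probability $1/2$; $\Phi\in\{0,1\}^{s\times m}$ has $\Phi_{h(i),i}=1$ for $1\le i\le m$ and all other entries $0$, where each $h(i)$ is uniformly distributed on $\{1,\dots,s\}$; and all the $h(i)$ and all the signs are independent. Let $\mathbf S\mathbf A=\mathbf Q\mathbf R$ be a QR decomposition, where $\mathbf Q\in\mathbb R^{s\times n}$ has orthonormal columns and $\mathbf R\in\mathbb R^{n\times n}$ is upper triangular. When $\mathbf R$ is invertible put $\mathbf B=\mathbf A\mathbf R^{-1}$, $\mathbf x_\star=\mathbf A^\dagger\mathbf b$ and $\mathbf y_\star=\mathbf B^\dagger\mathbf b$ (Moore–Penrose pseudoinverses). For an initial guess $\mathbf y^{(0)}$ let $\mathbf y^{(k)}$ be the $k$-th iterate,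 in exact arithmetic, of the LSQR method of Paige and Saunders for $\min_{\mathbf y}\|\mathbf B\mathbf y-\mathbf b\|_2$ (its bidiagonalization starting from the residual $\mathbf b-\mathbf B\mathbf y^{(0)}$, and the iterate staying constant after termination), and let $\mathbf x^{(k)}=\mathbf R^{-1}\mathbf y^{(k)}$. For a positive semidefinite matrix $\mathbf M$ write $\|\mathbf z\|_{\mathbf M}=\sqrt{\mathbf z^T\mathbf M\mathbf z}$. Let $\tau>0$ and let $k$ be an integer with $$k\ \ge\ \frac{\ln 2+|\ln\tau|}{|\ln\epsilon|}.$$ 1. With probability at least $1-\delta$, the matrix $\mathbf R$ is invertible and, for the initial guess $\mathbf y^{(0)}=\mathbf 0$, $$\|\mathbf y^{(k)}-\mathbf y_\star\|_{\mathbf B^T\mathbf B}\le\tau\,\|\mathbf y_\star\|_{\mathbf B^T\mathbf B}.$$ Whenever $\mathbf R$ is invertible, $\mathbf x_\star=\mathbf R^{-1}\mathbf y_\star$, and this inequality is equivalent to $$\|\mathbf x^{(k)}-\mathbf x_\star\|_{\mathbf A^T\mathbf A}\le\tau\,\|\mathbf x_\star\|_{\mathbf A^T\mathbf A}.$$ 2.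 With probability at least $1-\delta$, the matrix $\mathbf R$ is invertible and, for the initial guess $\mathbf y^{(0)}=\mathbf Q^T\mathbf S\mathbf b$, $$\|\mathbf A\mathbf x^{(k)}-\mathbf b\|_2\le\sqrt{2\Big(\frac{4\tau^2}{1-\epsilon}+1\Big)}\ \|\mathbf A\mathbf x_\star-\mathbf b\|_2 .$$ -/

import Mathlib

open Matrix MeasureTheory ProbabilityTheory

/-- The random seed of an `s × m` count sketch: a hash map `h : [m] → [s]` together with one
bit per column (`true` stands for the sign `+1`, `false` for the sign `-1`). -/
abbrev CountSketchSeed (s m : ℕ) : Type := (Fin m → Fin s) × (Fin m → Bool)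

/-- The sign encoded by a bit. -/
def signOfBit (β : Bool) : ℝ := if β then 1 else -1

/-- The count sketch matrix `S = Φ D`, where `Φ` is the binary matrix with `Φ (h i) i = 1` and
all other entries `0`, and `D` is the diagonal matrix of signs. -/
def countSketch {s m : ℕ} (ω : CountSketchSeed s m) : Matrix (Fin s) (Fin m) ℝ :=
  (Matrix.of fun j i => if ω.1 i = j then (1 : ℝ) else 0) *
    Matrix.diagonal fun i => signOfBit (ω.2 i)

/-- The law of the seed: the uniform probability measure on the finite set of seeds, i.e. all
values `h i` are uniform on `[s]`, all signs are `±1` with probability `1/2`, and all of these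
`2 m` random variables are independent. -/
noncomputable def countSketchLaw (s m : ℕ) : Measure (CountSketchSeed s m) :=
  uniformOn Set.univ

/-- The Euclidean norm on `ℝⁿ`. -/
noncomputable def l2norm {n : ℕ} (v : Fin n → ℝ) : ℝ := ‖WithLp.toLp 2 v‖

/-- The (semi)norm `‖x‖_M = √(xᵀ M x)` of a positive (semi)definite matrix `M`. -/
noncomputable def energyNorm {n : ℕ} (M : Matrix (Fin n) (Fin n) ℝ) (x : Fin n → ℝ) : ℝ :=
  √(x ⬝ᵥ (M *ᵥ x))

/-- `M = Q R` is a (thin) QR factorization: `Q` has orthonormal columns and `R` is upper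
triangular. -/
structure IsQR {s n : ℕ} (M Q : Matrix (Fin s) (Fin n) ℝ) (R : Matrix (Fin n) (Fin n) ℝ) :
    Prop where
  orthonormal : Qᵀ * Q = 1
  upper : ∀ i j, j < i → R i j = 0
  factor : Q * R = M

/-- The four Penrose equations: `X` is the Moore-Penrose pseudoinverse of `M`. -/
structure IsMoorePenrose {m n : ℕ} (M : Matrix (Fin m) (Fin n) ℝ)
    (X : Matrix (Fin n) (Fin m) ℝ) : Prop where
  mul_mul : M * X * M = M
  inv_mul_mul : X * M * X = X
  symm_left : (M * X)ᵀ = M * X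
  symm_right : (X * M)ᵀ = X * M

/-- The Moore-Penrose pseudoinverse `M†`, the unique solution of the Penrose equations. -/
noncomputable def pinv {m n : ℕ} (M : Matrix (Fin m) (Fin n) ℝ) : Matrix (Fin n) (Fin m) ℝ :=
  Classical.epsilon (IsMoorePenrose M)

/-- `v / ‖v‖₂`, which is `0` for `v = 0`. -/
noncomputable def unitize {n : ℕ} (v : Fin n → ℝ) : Fin n → ℝ := (l2norm v)⁻¹ • v

/-- The quantities carried by LSQR (Paige and Saunders) from one iteration to the next: the
current vectors `u`, `v` and number `alpha` of the Golub-Kahan bidiagonalization, the search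
direction `w`, the iterate `y`, and the numbers `rhobar`, `phibar` of the updated QR
factorization of the bidiagonal matrix. -/
structure LSQRState (m n : ℕ) where
  u : Fin m → ℝ
  v : Fin n → ℝ
  w : Fin n → ℝ
  y : Fin n → ℝ
  alpha : ℝ
  rhobar : ℝ
  phibar : ℝ

/-- Initialization of LSQR for `min ‖B y - b‖₂` with initial guess `y₀`: the bidiagonalization
starts from the initial residual, `β₁ u₁ = b - B y₀` and `α₁ v₁ = Bᵀ u₁`. -/
noncomputable def lsqrInit {m n : ℕ} (B : Matrix (Fin m) (Fin n) ℝ) (b : Fin m → ℝ)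
    (y₀ : Fin n → ℝ) : LSQRState m n :=
  let r := b - B *ᵥ y₀
  let u := unitize r
  let g := Bᵀ *ᵥ u
  { u := u, v := unitize g, w := unitize g, y := y₀,
    alpha := l2norm g, rhobar := l2norm g, phibar := l2norm r }

/-- One iteration of LSQR: continue the bidiagonalization by
`β' u' = B v - α u` and `α' v' = Bᵀ u' - β' v`, apply the next plane rotation, and update `y`
and `w`. The iteration terminates when `β' = 0` or `α' = 0`; with the convention `x / 0 = 0` all
later steps then leave `y` unchanged. -/
noncomputable def lsqrStep {m n : ℕ} (B : Matrix (Fin m) (Fin n) ℝ) (σ : LSQRState m n) :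
    LSQRState m n :=
  let p := B *ᵥ σ.v - σ.alpha • σ.u
  let beta' := l2norm p
  let u' := unitize p
  let q := Bᵀ *ᵥ u' - beta' • σ.v
  let alpha' := l2norm q
  let v' := unitize q
  let rho := √(σ.rhobar ^ 2 + beta' ^ 2)
  let c := σ.rhobar / rho
  let d := beta' / rho
  let theta := d * alpha'
  let phi := c * σ.phibar
  { u := u', v := v', w := v' - (theta / rho) • σ.w, y := σ.y + (phi / rho) • σ.w,
    alpha := alpha', rhobar := -c * alpha', phibar := d * σ.phibar }

/-- The `k`-th LSQR iterate `y⁽ᵏ⁾` for `min ‖B y - b‖₂` with initial guess `y₀`, in exact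
arithmetic. -/
noncomputable def lsqr {m n : ℕ} (B : Matrix (Fin m) (Fin n) ℝ) (b : Fin m → ℝ)
    (y₀ : Fin n → ℝ) (k : ℕ) : Fin n → ℝ :=
  ((lsqrStep B)^[k] (lsqrInit B b y₀)).y

/-! Write `A = U J` with `UᵀU = 1` and `J` invertible, so that `B = A R⁻¹ = U T` with `T = J R⁻¹`.
Since `S U T = Q` has orthonormal columns, `T Tᵀ` is the inverse of the sketched Gram matrix `(S
U)ᵀ(S U)`. If `S` distorts squared lengths on the range of `U` by a relative error at most `μ < 1`,
then `R` is invertible and every eigenvalue of `T Tᵀ` is `1/ν` with `|ν - 1| ≤ μ`. LSQR minimizes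
the residual over a Krylov space that contains the Richardson iterate of any step length `c`. Hence
its error `T(y - y⋆)` is at most `(1 - c T Tᵀ)^k T(y₀ - y⋆)` in norm (`lsqr_residual_le`,
`lsqr_error_le`), and `c` may be chosen afterwards. From the zero guess, `c = 1 - ε²` gives the
factor `ε^k ≤ τ`. Markov's inequality for the squared Frobenius norm of `(S U)ᵀ(S U) - 1`, whose
mean is at most `(n² + n)/s ≤ δ ε²`, gives the probability. From the sketched solution, the initial
error is `T Tᵀ g` scaled by `‖r‖`, where `r` is the optimal residual and `g = (S U)ᵀ S r/‖r‖`. A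
single application of Markov's inequality to `μ² + (1/ε - 1)‖g‖²`, with `μ` now the Frobenius norm,
controls both quantities. With `c = 1 - μ` the error is at most `‖r‖`, so the squared residual is at
most `2‖r‖²`, which is stronger than required. -/

/-! ### Euclidean norms and normalization. -/

theorem l2norm_nonneg {n : ℕ} (v : Fin n → ℝ) : 0 ≤ l2norm v := norm_nonneg _

theorem l2norm_sq {n : ℕ} (v : Fin n → ℝ) : l2norm v ^ 2 = v ⬝ᵥ v := by
  simp only [l2norm, EuclideanSpace.norm_sq_eq, dotProduct, Real.norm_eq_abs, sq_abs]
  exact Finset.sum_congr rfl fun i _ => sq _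

theorem l2norm_eq_zero {n : ℕ} {v : Fin n → ℝ} : l2norm v = 0 ↔ v = 0 := by
  simp [l2norm]

theorem l2norm_smul_unitize {n : ℕ} (v : Fin n → ℝ) : l2norm v • unitize v = v := by
  by_cases h : l2norm v = 0
  · rw [h, l2norm_eq_zero.1 h, zero_smul]
  · rw [unitize, smul_smul, mul_inv_cancel₀ h, one_smul]

theorem unitize_dotProduct_self {n : ℕ} {v : Fin n → ℝ} (h : l2norm v ≠ 0) :
    unitize v ⬝ᵥ unitize v = 1 := by
  rw [unitize, smul_dotProduct, dotProduct_smul, ← l2norm_sq, smul_eq_mul, smul_eq_mul]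
  field_simp

theorem unitize_eq_zero {n : ℕ} {v : Fin n → ℝ} (h : l2norm v = 0) : unitize v = 0 := by
  rw [unitize, h, _root_.inv_zero, zero_smul]

/-! ### LSQR, its invariant, and comparison with gradient descent. -/

/-- The Richardson (gradient descent) iterates for `min ‖B y - b‖₂` with step length `c`. -/
noncomputable def richardson {m n : ℕ} (B : Matrix (Fin m) (Fin n) ℝ) (b : Fin m → ℝ)
    (y₀ : Fin n → ℝ) (c : ℝ) (k : ℕ) : Fin n → ℝ :=
  (fun x => x + c • (Bᵀ *ᵥ (b - B *ᵥ x)))^[k] y₀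

/-- The iteration has stopped at a least squares solution. -/
structure LSQRState.Stopped {m n : ℕ} (σ : LSQRState m n) (B : Matrix (Fin m) (Fin n) ℝ)
    (b : Fin m → ℝ) : Prop where
  v_eq : σ.v = 0
  w_eq : σ.w = 0
  alpha_eq : σ.alpha = 0
  normal : Bᵀ *ᵥ (b - B *ᵥ σ.y) = 0

/-- The invariant of LSQR before termination. Here `K` and `L` are the spaces spanned by the
earlier vectors `v` and `u` of the bidiagonalization, `t` is the normalized residual, and `x` is
a point of `y₀ + K` with which the LSQR iterate is compared. -/
structure LSQRState.Running {m n : ℕ} (σ : LSQRState m n) (B : Matrix (Fin m) (Fin n) ℝ)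
    (b : Fin m → ℝ) (y₀ x : Fin n → ℝ) (K : Submodule ℝ (Fin n → ℝ))
    (L : Submodule ℝ (Fin m → ℝ)) (t : Fin m → ℝ) : Prop where
  u_unit : σ.u ⬝ᵥ σ.u = 1
  v_unit : σ.v ⬝ᵥ σ.v = 1
  rhobar_ne : σ.rhobar ≠ 0
  v_orth : ∀ z ∈ K, z ⬝ᵥ σ.v = 0
  u_orth : ∀ z ∈ L, z ⬝ᵥ σ.u = 0
  transpose_mem : ∀ z ∈ L, Bᵀ *ᵥ z ∈ K
  mulVec_mem : ∀ z ∈ K, B *ᵥ z ∈ L ⊔ Submodule.span ℝ {σ.u}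
  transpose_u : Bᵀ *ᵥ σ.u - σ.alpha • σ.v ∈ K
  w_mem : σ.w - σ.v ∈ K
  y_mem : σ.y - y₀ ∈ K
  x_mem : x - y₀ ∈ K
  resid_mem : b - B *ᵥ y₀ ∈ L ⊔ Submodule.span ℝ {σ.u}
  mulVec_w : B *ᵥ σ.w = B *ᵥ σ.v + σ.rhobar • t - σ.alpha • σ.u
  transpose_t : Bᵀ *ᵥ t = σ.rhobar • σ.v
  resid : b - B *ᵥ σ.y = σ.phibar • t

/-- The conventions `x / 0 = 0` and `unitize 0 = 0` make every new vector vanish, and `w = 0`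
freezes `y`. -/
theorem LSQRState.Stopped.step {m n : ℕ} {σ : LSQRState m n} {B : Matrix (Fin m) (Fin n) ℝ}
    {b : Fin m → ℝ} (h : σ.Stopped B b) : (lsqrStep B σ).Stopped B b := by
  have hp : B *ᵥ σ.v - σ.alpha • σ.u = 0 := by simp [h.v_eq, h.alpha_eq]
  have h0 : ∀ k, l2norm (0 : Fin k → ℝ) = 0 := fun k => l2norm_eq_zero.2 rfl
  have u0 : ∀ k, unitize (0 : Fin k → ℝ) = 0 := fun k => unitize_eq_zero (h0 k)
  constructor <;> simp [lsqrStep, hp, h0, u0, h.w_eq, h.normal]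

/-- The spaces grow by `v` and `u`. The two-term recurrences preserve orthogonality because `B` and
`Bᵀ` are adjoint and map `K`, `L` into each other up to one new direction. A gradient step from `x`
stays in `y₀ + K'`, whatever `c₀` is. -/
theorem LSQRState.Running.step {m n : ℕ} {σ : LSQRState m n} {B : Matrix (Fin m) (Fin n) ℝ}
    {b : Fin m → ℝ} {y₀ x : Fin n → ℝ} {K : Submodule ℝ (Fin n → ℝ)}
    {L : Submodule ℝ (Fin m → ℝ)} {t : Fin m → ℝ} (h : σ.Running B b y₀ x K L t) (c₀ : ℝ) :
    (lsqrStep B σ).Stopped B b ∨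
      ∃ K' L' t', (lsqrStep B σ).Running B b y₀ (x + c₀ • (Bᵀ *ᵥ (b - B *ᵥ x))) K' L' t' := by
  set σ' := lsqrStep B σ with hσ
  set p := B *ᵥ σ.v - σ.alpha • σ.u with hp
  set β := l2norm p with hβ
  set q := Bᵀ *ᵥ σ'.u - β • σ.v with hq
  set ρ := √(σ.rhobar ^ 2 + β ^ 2) with hρ
  have hρ2 : ρ ^ 2 = σ.rhobar ^ 2 + β ^ 2 := Real.sq_sqrt (by positivity)
  have hρ0 : ρ ≠ 0 := by
    have : 0 < σ.rhobar ^ 2 := by have := h.rhobar_ne; positivity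
    intro h0; rw [h0] at hρ2; nlinarith [sq_nonneg β]
  set c := σ.rhobar / ρ with hc
  set d := β / ρ with hd
  have hcρ : c * ρ = σ.rhobar := div_mul_cancel₀ _ hρ0
  have hdρ : d * ρ = β := div_mul_cancel₀ _ hρ0
  have hcd : c ^ 2 + d ^ 2 = 1 := by
    rw [hc, hd, div_pow, div_pow, ← add_div, ← hρ2, div_self (pow_ne_zero 2 hρ0)]
  have eu : σ'.u = unitize p := rfl
  have ev : σ'.v = unitize q := rfl
  have ea : σ'.alpha = l2norm q := rfl
  have ew : σ'.w = σ'.v - (d * σ'.alpha / ρ) • σ.w := rfl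
  have ey : σ'.y = σ.y + (c * σ.phibar / ρ) • σ.w := rfl
  have er : σ'.rhobar = -c * σ'.alpha := rfl
  have ef : σ'.phibar = d * σ.phibar := rfl
  have hBv : B *ᵥ σ.v = σ.alpha • σ.u + β • σ'.u := by
    rw [eu, l2norm_smul_unitize, hp]; abel
  have hTu : Bᵀ *ᵥ σ'.u = σ'.alpha • σ'.v + β • σ.v := by
    rw [ea, ev, l2norm_smul_unitize, hq]; abel
  have hBw : B *ᵥ σ.w = ρ • (c • t + d • σ'.u) := by
    rw [h.mulVec_w, hBv, ← hcρ, ← hdρ]; module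
  -- The plane rotation sends `t`, `u'` to `c t + d u'`, which is parallel to `B w` and is removed
  -- by the update of `y`, and to `t'`, which carries the new residual.
  set t' := d • t - c • σ'.u with ht'
  have hTt : Bᵀ *ᵥ t' = σ'.rhobar • σ'.v := by
    rw [ht', mulVec_sub, mulVec_smul, mulVec_smul, h.transpose_t, hTu, er, ← hcρ, ← hdρ]; module
  have hres : b - B *ᵥ σ'.y = σ'.phibar • t' := by
    rw [ey, mulVec_add, ← sub_sub, h.resid, mulVec_smul, hBw, ef, smul_smul,
      div_mul_cancel₀ _ hρ0, ht']
    linear_combination (norm := module) (-σ.phibar * hcd) • t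
  by_cases ha : σ'.alpha = 0
  · left
    have hv : σ'.v = 0 := by rw [ev]; exact unitize_eq_zero ha
    exact ⟨hv, by rw [ew, hv, ha]; simp, ha, by rw [hres, mulVec_smul, hTt, hv]; simp⟩
  right
  -- Termination through `β' = 0` is already covered, since it forces `α' = 0`.
  have hβ0 : β ≠ 0 := by
    intro h0
    have hu : σ'.u = 0 := unitize_eq_zero h0
    apply ha
    rw [ea, l2norm_eq_zero, hq, hu, h0]; simp
  have huu : σ'.u ⬝ᵥ σ'.u = 1 := unitize_dotProduct_self hβ0
  have hvv : σ'.v ⬝ᵥ σ'.v = 1 := unitize_dotProduct_self ha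
  set K' := K ⊔ Submodule.span ℝ {σ.v} with hK'
  set L' := L ⊔ Submodule.span ℝ {σ.u} with hL'
  have vK : σ.v ∈ K' := Submodule.mem_sup_right (Submodule.mem_span_singleton_self _)
  have uL : σ.u ∈ L' := Submodule.mem_sup_right (Submodule.mem_span_singleton_self _)
  have KK : ∀ z ∈ K, z ∈ K' := fun z hz => Submodule.mem_sup_left hz
  have LL : ∀ z ∈ L', z ∈ L' ⊔ Submodule.span ℝ {σ'.u} := fun z hz => Submodule.mem_sup_left hz
  have uuL : σ'.u ∈ L' ⊔ Submodule.span ℝ {σ'.u} :=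
    Submodule.mem_sup_right (Submodule.mem_span_singleton_self _)
  have adj : ∀ (z : Fin n → ℝ) (z' : Fin m → ℝ), (Bᵀ *ᵥ z') ⬝ᵥ z = z' ⬝ᵥ (B *ᵥ z) := by
    intro z z'; rw [mulVec_transpose, dotProduct_mulVec]
  have wK : σ.w ∈ K' := by
    have := K'.add_mem (KK _ h.w_mem) vK
    rwa [sub_add_cancel] at this
  have uorth : ∀ z ∈ L', z ⬝ᵥ σ'.u = 0 := by
    intro z hz
    have key : z ⬝ᵥ (β • σ'.u) = 0 := by
      rw [eu, l2norm_smul_unitize, hp]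
      obtain ⟨z₁, hz₁, z₂, hz₂, rfl⟩ := Submodule.mem_sup.1 hz
      obtain ⟨a, rfl⟩ := Submodule.mem_span_singleton.1 hz₂
      have e1 : (z₁ ⬝ᵥ B *ᵥ σ.v) = 0 := by
        rw [← adj]; exact h.v_orth _ (h.transpose_mem _ hz₁)
      have e2 : σ.u ⬝ᵥ B *ᵥ σ.v = σ.alpha := by
        have := h.v_orth _ h.transpose_u
        rw [sub_dotProduct, smul_dotProduct, h.v_unit, adj, smul_eq_mul] at this
        linarith
      simp only [add_dotProduct, dotProduct_sub, smul_dotProduct, dotProduct_smul, e1, e2,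
        h.u_orth _ hz₁, h.u_unit, smul_eq_mul]
      ring
    rw [dotProduct_smul, smul_eq_mul] at key
    exact (mul_eq_zero.1 key).resolve_left hβ0
  have mapK : ∀ z ∈ K', B *ᵥ z ∈ L' ⊔ Submodule.span ℝ {σ'.u} := by
    intro z hz
    obtain ⟨z₁, hz₁, z₂, hz₂, rfl⟩ := Submodule.mem_sup.1 hz
    obtain ⟨a, rfl⟩ := Submodule.mem_span_singleton.1 hz₂
    rw [mulVec_add, mulVec_smul, hBv]
    refine Submodule.add_mem _ (LL _ (h.mulVec_mem _ hz₁)) (Submodule.smul_mem _ _ ?_)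
    exact Submodule.add_mem _ (Submodule.smul_mem _ _ (LL _ uL)) (Submodule.smul_mem _ _ uuL)
  have mapL : ∀ z ∈ L', Bᵀ *ᵥ z ∈ K' := by
    intro z hz
    obtain ⟨z₁, hz₁, z₂, hz₂, rfl⟩ := Submodule.mem_sup.1 hz
    obtain ⟨a, rfl⟩ := Submodule.mem_span_singleton.1 hz₂
    rw [mulVec_add, mulVec_smul]
    refine K'.add_mem (KK _ (h.transpose_mem _ hz₁)) (K'.smul_mem _ ?_)
    have := K'.add_mem (KK _ h.transpose_u) (K'.smul_mem σ.alpha vK)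
    rwa [sub_add_cancel] at this
  have vorth : ∀ z ∈ K', z ⬝ᵥ σ'.v = 0 := by
    intro z hz
    have key : z ⬝ᵥ (σ'.alpha • σ'.v) = 0 := by
      rw [ea, ev, l2norm_smul_unitize, hq]
      obtain ⟨z₁, hz₁, z₂, hz₂, rfl⟩ := Submodule.mem_sup.1 hz
      obtain ⟨a, rfl⟩ := Submodule.mem_span_singleton.1 hz₂
      have e1 : (z₁ ⬝ᵥ Bᵀ *ᵥ σ'.u) = 0 := by
        rw [dotProduct_comm, adj, dotProduct_comm]; exact uorth _ (h.mulVec_mem _ hz₁)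
      have e2 : σ.v ⬝ᵥ Bᵀ *ᵥ σ'.u = β := by
        rw [dotProduct_comm, adj, hBv, dotProduct_add, dotProduct_smul, dotProduct_smul, huu,
          dotProduct_comm, uorth _ uL, smul_eq_mul, smul_eq_mul]
        ring
      simp only [add_dotProduct, dotProduct_sub, smul_dotProduct, dotProduct_smul, e1, e2,
        h.v_orth _ hz₁, h.v_unit, smul_eq_mul]
      ring
    rw [dotProduct_smul, smul_eq_mul] at key
    exact (mul_eq_zero.1 key).resolve_left ha
  refine ⟨K', L', t', huu, hvv, ?_, vorth, uorth, mapL, mapK, ?_, ?_, ?_, ?_, LL _ h.resid_mem,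
    ?_, hTt, hres⟩
  · rw [er]
    exact mul_ne_zero (neg_ne_zero.2 (div_ne_zero h.rhobar_ne hρ0)) ha
  · rw [hTu, add_sub_cancel_left]; exact K'.smul_mem _ vK
  · rw [ew, sub_sub_cancel_left]; exact K'.neg_mem (K'.smul_mem _ wK)
  · rw [ey, add_sub_right_comm]; exact K'.add_mem (KK _ h.y_mem) (K'.smul_mem _ wK)
  · rw [add_sub_right_comm]
    refine K'.add_mem (KK _ h.x_mem) (K'.smul_mem _ (mapL _ ?_))
    have : b - B *ᵥ x = (b - B *ᵥ y₀) - B *ᵥ (x - y₀) := by rw [mulVec_sub]; abel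
    rw [this]
    exact L'.sub_mem h.resid_mem (h.mulVec_mem _ h.x_mem)
  · rw [ew, mulVec_sub, mulVec_smul, hBw, smul_smul, div_mul_cancel₀ _ hρ0, er, ht']
    linear_combination (norm := module) (-σ'.alpha * hcd) • σ'.u

theorem lsqr_invariant {m n : ℕ} (B : Matrix (Fin m) (Fin n) ℝ) (b : Fin m → ℝ)
    (y₀ : Fin n → ℝ) (c : ℝ) (k : ℕ) :
    ((lsqrStep B)^[k] (lsqrInit B b y₀)).Stopped B b ∨
      ∃ K L t, ((lsqrStep B)^[k] (lsqrInit B b y₀)).Running B b y₀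
        (richardson B b y₀ c k) K L t := by
  induction k with
  | zero =>
    set σ := lsqrInit B b y₀ with hσ
    have eu : σ.u = unitize (b - B *ᵥ y₀) := rfl
    have ev : σ.v = unitize (Bᵀ *ᵥ σ.u) := rfl
    have ew : σ.w = σ.v := rfl
    have ea : σ.alpha = l2norm (Bᵀ *ᵥ σ.u) := rfl
    have er : σ.rhobar = σ.alpha := rfl
    have ef : σ.phibar = l2norm (b - B *ᵥ y₀) := rfl
    have ey : σ.y = y₀ := rfl
    have hr : b - B *ᵥ y₀ = σ.phibar • σ.u := by rw [ef, eu, l2norm_smul_unitize]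
    have hTu : Bᵀ *ᵥ σ.u = σ.alpha • σ.v := by rw [ea, ev, l2norm_smul_unitize]
    simp only [Function.iterate_zero, id_eq, richardson]
    by_cases ha : σ.alpha = 0
    · left
      have hv : σ.v = 0 := unitize_eq_zero ha
      exact ⟨hv, ew.trans hv, ha, by rw [ey, hr, mulVec_smul, hTu, hv]; simp⟩
    · right
      have hu : l2norm (b - B *ᵥ y₀) ≠ 0 := by
        intro h0
        apply ha
        rw [ea, eu, unitize_eq_zero h0, mulVec_zero]
        exact l2norm_eq_zero.2 rfl
      refine ⟨⊥, ⊥, σ.u, unitize_dotProduct_self hu, unitize_dotProduct_self ha, ha, ?_, ?_, ?_,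
        ?_, ?_, ?_, ?_, ?_, ?_, ?_, hTu, hr⟩
      · simp +contextual
      · simp +contextual
      · simp +contextual
      · simp +contextual
      · rw [hTu]; simp
      · simp [ew]
      · simp [ey]
      · simp
      · rw [hr]
        exact Submodule.mem_sup_right
          (Submodule.smul_mem _ _ (Submodule.mem_span_singleton_self _))
      · rw [ew, er]; abel
  | succ k ih =>
    simp only [richardson, Function.iterate_succ_apply']
    rcases ih with h | ⟨K, L, t, h⟩
    · exact Or.inl h.step
    · exact h.step c

/-- LSQR is optimal over the Krylov space; in particular, it is at least as good as every
stationary gradient iteration. -/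
theorem lsqr_residual_le {m n : ℕ} (B : Matrix (Fin m) (Fin n) ℝ) (b : Fin m → ℝ)
    (y₀ : Fin n → ℝ) (c : ℝ) (k : ℕ) :
    (b - B *ᵥ lsqr B b y₀ k) ⬝ᵥ (b - B *ᵥ lsqr B b y₀ k) ≤
      (b - B *ᵥ richardson B b y₀ c k) ⬝ᵥ (b - B *ᵥ richardson B b y₀ c k) := by
  set y := lsqr B b y₀ k with hy
  set x := richardson B b y₀ c k with hx
  -- The gradient at `y` is zero or a multiple of `v`, which is orthogonal to `K ∋ x - y`. The bound
  -- is then Pythagoras.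
  have key : (b - B *ᵥ y) ⬝ᵥ (B *ᵥ (x - y)) = 0 := by
    rw [dotProduct_mulVec, ← mulVec_transpose]
    rcases lsqr_invariant B b y₀ c k with h | ⟨K, L, t, h⟩
    · have := h.normal
      change Bᵀ *ᵥ (b - B *ᵥ y) = 0 at this
      rw [this, zero_dotProduct]
    · have h1 := h.resid
      change b - B *ᵥ y = _ at h1
      have h2 : x - y ∈ K := by
        have := K.sub_mem h.x_mem h.y_mem
        rwa [sub_sub_sub_cancel_right] at this
      rw [h1, mulVec_smul, h.transpose_t, smul_dotProduct, smul_dotProduct, dotProduct_comm,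
        h.v_orth _ h2, smul_zero, smul_zero]
  have e : b - B *ᵥ x = (b - B *ᵥ y) - B *ᵥ (x - y) := by rw [mulVec_sub]; abel
  have h0 : 0 ≤ (B *ᵥ (x - y)) ⬝ᵥ (B *ᵥ (x - y)) := by rw [← l2norm_sq]; positivity
  rw [e]
  generalize b - B *ᵥ y = r at *
  rw [sub_dotProduct, dotProduct_sub, dotProduct_sub, dotProduct_comm (B *ᵥ (x - y)) r, key]
  linarith

/-! ### Moments of the count sketch and Markov's inequality. -/

theorem signOfBit_not (β : Bool) : signOfBit (!β) = -signOfBit β := by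
  cases β <;> simp [signOfBit]

theorem signOfBit_mul_self (β : Bool) : signOfBit β * signOfBit β = 1 := by
  cases β <;> simp [signOfBit]

/-- A function of the signs that changes sign when the `i`-th sign does has mean zero. -/
theorem sum_signs_eq_zero {m : ℕ} (i : Fin m) (f : (Fin m → Bool) → ℝ)
    (hf : ∀ σ, f (Function.update σ i (!σ i)) = -f σ) : ∑ σ, f σ = 0 := by
  have hinv : Function.Involutive fun σ : Fin m → Bool => Function.update σ i (!σ i) := by
    intro σ; simp
  have h := Equiv.sum_comp (Function.Involutive.toPerm _ hinv) f
  have h2 : ∑ σ, f (Function.Involutive.toPerm _ hinv σ) = -∑ σ, f σ := by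
    rw [← Finset.sum_neg_distrib]
    exact Finset.sum_congr rfl fun σ _ => hf σ
  linarith

theorem sum_sign_mul_sign {m : ℕ} (i j : Fin m) :
    ∑ σ : Fin m → Bool, signOfBit (σ i) * signOfBit (σ j) = if i = j then 2 ^ m else 0 := by
  split_ifs with h
  · subst h; simp [signOfBit_mul_self]
  · exact sum_signs_eq_zero i _ fun σ => by
      rw [Function.update_self, Function.update_of_ne (Ne.symm h), signOfBit_not]; ring

/-- Unless the pairs coincide as sets, some index occurs exactly once and flipping its sign cancels
the sum. -/
theorem sum_sign_four {m : ℕ} {i j k l : Fin m} (hij : i ≠ j) (hkl : k ≠ l) :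
    ∑ σ : Fin m → Bool, (signOfBit (σ i) * signOfBit (σ j)) * (signOfBit (σ k) * signOfBit (σ l)) =
      2 ^ m * ((if i = k ∧ j = l then 1 else 0) + if i = l ∧ j = k then 1 else 0) := by
  by_cases hik : i = k
  · subst hik
    have : ∀ σ : Fin m → Bool, (signOfBit (σ i) * signOfBit (σ j)) *
        (signOfBit (σ i) * signOfBit (σ l)) = signOfBit (σ j) * signOfBit (σ l) := fun σ => by
      linear_combination signOfBit (σ j) * signOfBit (σ l) * signOfBit_mul_self (σ i)
    simp [this, sum_sign_mul_sign, hkl]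
  by_cases hil : i = l
  · subst hil
    have : ∀ σ : Fin m → Bool, (signOfBit (σ i) * signOfBit (σ j)) *
        (signOfBit (σ k) * signOfBit (σ i)) = signOfBit (σ j) * signOfBit (σ k) := fun σ => by
      linear_combination signOfBit (σ j) * signOfBit (σ k) * signOfBit_mul_self (σ i)
    simp [this, sum_sign_mul_sign, hik]
  · rw [if_neg (by tauto), if_neg (by tauto)]
    rw [sum_signs_eq_zero i _ fun σ => ?_]
    · ring
    · rw [Function.update_self, Function.update_of_ne (Ne.symm hij),
        Function.update_of_ne (Ne.symm hik), Function.update_of_ne (Ne.symm hil), signOfBit_not]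
      ring

/-- The second moment of an off-diagonal Rademacher chaos of order two. -/
theorem sum_signs_chaos_sq {m : ℕ} (a : Fin m → Fin m → ℝ) :
    ∑ σ : Fin m → Bool, (∑ i, ∑ j, if i = j then 0 else
      signOfBit (σ i) * signOfBit (σ j) * a i j) ^ 2 =
      2 ^ m * ∑ i, ∑ j, if i = j then 0 else a i j * (a i j + a j i) := by
  have key : ∀ i j k l : Fin m, ∑ σ : Fin m → Bool,
      (if i = j then 0 else signOfBit (σ i) * signOfBit (σ j) * a i j) *
      (if k = l then 0 else signOfBit (σ k) * signOfBit (σ l) * a k l) =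
      if i = j then 0 else 2 ^ m * ((if i = k then if j = l then a i j * a k l else 0 else 0) +
        if i = l then if j = k then a i j * a k l else 0 else 0) := by
    intro i j k l
    by_cases hij : i = j
    · simp [hij]
    by_cases hkl : k = l
    · subst hkl
      simp only [if_true, mul_zero, Finset.sum_const_zero, hij, if_false]
      split_ifs <;> simp_all
    · have : ∀ σ : Fin m → Bool, (signOfBit (σ i) * signOfBit (σ j) * a i j) *
        (signOfBit (σ k) * signOfBit (σ l) * a k l) = a i j * a k l * ((signOfBit (σ i) *
          signOfBit (σ j)) * (signOfBit (σ k) * signOfBit (σ l))) := fun σ => by ring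
      simp only [if_neg hij, if_neg hkl, this, ← Finset.mul_sum, sum_sign_four hij hkl, ite_and]
      split_ifs <;> ring
  simp only [sq, Finset.sum_mul_sum]
  rw [Finset.sum_comm, Finset.mul_sum]
  refine Finset.sum_congr rfl fun i _ => ?_
  have : ∀ σ : Fin m → Bool, ∑ k, ∑ j, ∑ l,
      (if i = j then 0 else signOfBit (σ i) * signOfBit (σ j) * a i j) *
      (if k = l then 0 else signOfBit (σ k) * signOfBit (σ l) * a k l) = ∑ j, ∑ k, ∑ l,
      (if i = j then 0 else signOfBit (σ i) * signOfBit (σ j) * a i j) *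
      (if k = l then 0 else signOfBit (σ k) * signOfBit (σ l) * a k l) :=
    fun σ => Finset.sum_comm
  simp only [this]
  rw [Finset.sum_comm, Finset.mul_sum]
  refine Finset.sum_congr rfl fun j _ => ?_
  rw [Finset.sum_comm]
  simp only [Finset.sum_comm (γ := Fin m → Bool), key]
  rw [Finset.sum_comm]
  by_cases hij : i = j
  · simp [hij]
  · simp only [if_neg hij, ← Finset.mul_sum, Finset.sum_add_distrib]
    simp [Finset.sum_ite_eq]
    ring

/-- Two different columns are hashed to the same row with probability `1 / s`. -/
theorem sum_hash_collision {s m : ℕ} [NeZero s] {i j : Fin m} (hij : i ≠ j) :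
    ∑ h : Fin m → Fin s, (if h i = h j then (1 : ℝ) else 0) = s ^ m / s := by
  -- Translating the value `h i` by `a` permutes the hash maps, so every difference `h j - h i` is
  -- equally frequent.
  have shift : ∀ a : Fin s, ∑ h : Fin m → Fin s, (if h i = h j then (1 : ℝ) else 0) =
      ∑ h : Fin m → Fin s, (if a = h j - h i then (1 : ℝ) else 0) := by
    intro a
    rw [← Equiv.sum_comp (Equiv.addRight (Pi.single i a : Fin m → Fin s))]
    refine Finset.sum_congr rfl fun h _ => ?_
    simp [hij.symm, eq_sub_iff_add_eq']
  have total : (s : ℝ) * ∑ h : Fin m → Fin s, (if h i = h j then (1 : ℝ) else 0) = s ^ m := by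
    have : ∑ a : Fin s, ∑ h : Fin m → Fin s, (if h i = h j then (1 : ℝ) else 0) = s ^ m := by
      rw [Finset.sum_congr rfl fun a _ => shift a, Finset.sum_comm]
      simp
    simpa using this
  rw [eq_div_iff (Nat.cast_ne_zero.2 (NeZero.ne s)), mul_comm, total]

/-- The error that a count sketch makes in an inner product. -/
def sketchError {s m : ℕ} (ω : CountSketchSeed s m) (x y : Fin m → ℝ) : ℝ :=
  (countSketch ω *ᵥ x) ⬝ᵥ (countSketch ω *ᵥ y) - x ⬝ᵥ y

/-- The diagonal terms are reproduced exactly because signs square to one. What remains is an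
off-diagonal Rademacher chaos. -/
theorem sketchError_eq {s m : ℕ} (ω : CountSketchSeed s m) (x y : Fin m → ℝ) :
    sketchError ω x y = ∑ i, ∑ j, if i = j then 0 else
      signOfBit (ω.2 i) * signOfBit (ω.2 j) *
        ((if ω.1 i = ω.1 j then 1 else 0) * (x i * y j)) := by
  have hS : ∀ z : Fin m → ℝ, ∀ a, (countSketch ω *ᵥ z) a =
      ∑ i, if ω.1 i = a then signOfBit (ω.2 i) * z i else 0 := by
    intro z a
    simp only [countSketch, mulVec, dotProduct, mul_diagonal, of_apply]
    exact Finset.sum_congr rfl fun i _ => by split_ifs <;> simp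
  have hdot : (countSketch ω *ᵥ x) ⬝ᵥ (countSketch ω *ᵥ y) = ∑ i, ∑ j,
      signOfBit (ω.2 i) * signOfBit (ω.2 j) *
        ((if ω.1 i = ω.1 j then 1 else 0) * (x i * y j)) := by
    simp only [dotProduct, hS, Finset.sum_mul_sum]
    rw [Finset.sum_comm]
    refine Finset.sum_congr rfl fun i _ => ?_
    rw [Finset.sum_comm]
    refine Finset.sum_congr rfl fun j _ => ?_
    have : ∀ a : Fin s, (if ω.1 i = a then signOfBit (ω.2 i) * x i else 0) *
        (if ω.1 j = a then signOfBit (ω.2 j) * y j else 0) = if ω.1 i = a then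
          (if ω.1 j = ω.1 i then signOfBit (ω.2 i) * x i * (signOfBit (ω.2 j) * y j) else 0)
          else 0 := by
      intro a
      by_cases h : ω.1 i = a
      · subst h; simp
      · simp [h]
    simp only [this, Finset.sum_ite_eq, Finset.mem_univ, if_true]
    by_cases h : ω.1 i = ω.1 j
    · simp only [h, if_true]; ring
    · simp [h, Ne.symm h]
  have hxy : x ⬝ᵥ y = ∑ i, ∑ j, if i = j then x i * y j else 0 := by
    simp [dotProduct]
  rw [sketchError, hdot, hxy, ← Finset.sum_sub_distrib]
  refine Finset.sum_congr rfl fun i _ => ?_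
  rw [← Finset.sum_sub_distrib]
  refine Finset.sum_congr rfl fun j _ => ?_
  by_cases h : i = j
  · subst h
    simp only [if_true]
    linear_combination x i * y i * signOfBit_mul_self (ω.2 i)
  · simp [h]

theorem sum_sketchError_sq_le {s m : ℕ} [NeZero s] (x y : Fin m → ℝ) :
    ∑ ω : CountSketchSeed s m, sketchError ω x y ^ 2 ≤
      Fintype.card (CountSketchSeed s m) * (((x ⬝ᵥ x) * (y ⬝ᵥ y) + (x ⬝ᵥ y) ^ 2) / s) := by
  have hcard : (Fintype.card (CountSketchSeed s m) : ℝ) = s ^ m * 2 ^ m := by simp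
  have hsum : ∑ ω : CountSketchSeed s m, sketchError ω x y ^ 2 = 2 ^ m * ∑ i, ∑ j,
      if i = j then 0 else s ^ m / s * (x i * y j * (x i * y j + x j * y i)) := by
    rw [Fintype.sum_prod_type]
    have hσ : ∀ h : Fin m → Fin s, ∑ σ : Fin m → Bool, sketchError (h, σ) x y ^ 2 =
        2 ^ m * ∑ i, ∑ j, if i = j then 0 else (if h i = h j then 1 else 0) * (x i * y j) *
          ((if h i = h j then 1 else 0) * (x i * y j) +
            (if h j = h i then 1 else 0) * (x j * y i)) := fun h => by
      simp only [sketchError_eq]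
      exact sum_signs_chaos_sq fun i j => (if h i = h j then 1 else 0) * (x i * y j)
    simp only [hσ]
    rw [← Finset.mul_sum]
    congr 1
    rw [Finset.sum_comm]
    refine Finset.sum_congr rfl fun i _ => ?_
    rw [Finset.sum_comm]
    refine Finset.sum_congr rfl fun j _ => ?_
    split_ifs with h
    · simp
    · rw [← sum_hash_collision h, Finset.sum_mul]
      refine Finset.sum_congr rfl fun g _ => ?_
      simp only [eq_comm (a := g j)]
      split_ifs <;> ring
  -- Restoring the diagonal only adds terms `2 (x i * y i)²`, and the full sum factors into inner
  -- products.
  have hle : ∑ i, ∑ j, (if i = j then 0 else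
      (s : ℝ) ^ m / s * (x i * y j * (x i * y j + x j * y i))) ≤
      ∑ i, ∑ j, (s : ℝ) ^ m / s * (x i * y j * (x i * y j + x j * y i)) := by
    refine Finset.sum_le_sum fun i _ => Finset.sum_le_sum fun j _ => ?_
    split_ifs with h
    · subst h
      have : 0 ≤ x i * y i * (x i * y i + x i * y i) := by nlinarith [sq_nonneg (x i * y i)]
      positivity
    · exact le_rfl
  have hfull : ∑ i, ∑ j, (s : ℝ) ^ m / s * (x i * y j * (x i * y j + x j * y i)) =
      s ^ m / s * ((x ⬝ᵥ x) * (y ⬝ᵥ y) + (x ⬝ᵥ y) ^ 2) := by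
    simp only [dotProduct, sq, Finset.sum_mul_sum, ← Finset.sum_add_distrib]
    simp only [← Finset.mul_sum (a := (s : ℝ) ^ m / s)]
    congr 1
    exact Finset.sum_congr rfl fun i _ => Finset.sum_congr rfl fun j _ => by ring
  rw [hsum, hcard]
  calc _ ≤ 2 ^ m * (s ^ m / s * ((x ⬝ᵥ x) * (y ⬝ᵥ y) + (x ⬝ᵥ y) ^ 2)) := by
        rw [← hfull]; gcongr
    _ = _ := by ring

/-- Markov's inequality for the uniform law on the seeds. -/
theorem countSketchLaw_real_ge {s m : ℕ} [NeZero s] (f : CountSketchSeed s m → ℝ)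
    (hf : ∀ ω, 0 ≤ f ω) {a E δ : ℝ} (ha : 0 < a) (hE : E ≤ δ * a)
    (hsum : ∑ ω, f ω ≤ Fintype.card (CountSketchSeed s m) * E) (G : Set (CountSketchSeed s m))
    (hG : ∀ ω, f ω < a → ω ∈ G) : 1 - δ ≤ (countSketchLaw s m).real G := by
  classical
  have hN : (0 : ℝ) < Fintype.card (CountSketchSeed s m) := by
    exact_mod_cast Fintype.card_pos
  have hreal : (countSketchLaw s m).real G =
      ((Finset.univ.filter (· ∈ G)).card : ℝ) / Fintype.card (CountSketchSeed s m) := by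
    have : G = ((Finset.univ.filter (· ∈ G) : Finset (CountSketchSeed s m)) : Set _) := by
      ext; simp
    rw [Measure.real, countSketchLaw, uniformOn_univ]
    conv_lhs => rw [this, Measure.count_apply_finset]
    simp
  have hcompl : ((Finset.univ.filter (· ∈ G)).card : ℝ) + (Finset.univ.filter (· ∉ G)).card =
      Fintype.card (CountSketchSeed s m) := by
    exact_mod_cast Finset.card_filter_add_card_filter_not (s := Finset.univ) (· ∈ G)
  have hbad : ((Finset.univ.filter (· ∉ G)).card : ℝ) * a ≤ ∑ ω, f ω := by
    calc _ = ∑ ω ∈ Finset.univ.filter (· ∉ G), a := by simp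
      _ ≤ ∑ ω ∈ Finset.univ.filter (· ∉ G), f ω := by
          refine Finset.sum_le_sum fun ω hω => ?_
          by_contra hlt
          exact (Finset.mem_filter.1 hω).2 (hG ω (not_le.1 hlt))
      _ ≤ ∑ ω, f ω := Finset.sum_le_sum_of_subset_of_nonneg (Finset.filter_subset _ _)
          fun ω _ _ => hf ω
  rw [hreal, le_div_iff₀ hN]
  have : ((Finset.univ.filter (· ∉ G)).card : ℝ) * a ≤
      (δ * Fintype.card (CountSketchSeed s m)) * a := by
    calc _ ≤ _ := hbad.trans hsum
      _ ≤ Fintype.card (CountSketchSeed s m) * (δ * a) := by gcongr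
      _ = _ := by ring
  have := le_of_mul_le_mul_right this ha
  linarith

/-! ### Full column rank, pseudoinverses and right preconditioning. -/

theorem mulVec_injective_of_rank_eq {m n : ℕ} {A : Matrix (Fin m) (Fin n) ℝ} (hA : A.rank = n) :
    Function.Injective A.mulVec := by
  have h := A.mulVecLin.finrank_range_add_finrank_ker
  rw [Module.finrank_fin_fun] at h
  have h2 : Module.finrank ℝ (LinearMap.range A.mulVecLin) = n := hA
  have h3 : LinearMap.ker A.mulVecLin = ⊥ := Submodule.finrank_eq_zero.1 (by omega)
  exact LinearMap.ker_eq_bot.1 h3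

theorem dotProduct_gram {m n : ℕ} (A : Matrix (Fin m) (Fin n) ℝ) (x y : Fin n → ℝ) :
    x ⬝ᵥ ((Aᵀ * A) *ᵥ y) = (A *ᵥ x) ⬝ᵥ (A *ᵥ y) := by
  rw [← mulVec_mulVec, mulVec_transpose, dotProduct_comm, ← dotProduct_mulVec, dotProduct_comm]

theorem isUnit_gram {m n : ℕ} {A : Matrix (Fin m) (Fin n) ℝ}
    (hA : Function.Injective A.mulVec) : IsUnit (Aᵀ * A) := by
  have := PosDef.conjTranspose_mul_self A hA
  rw [conjTranspose_eq_transpose_of_trivial] at this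
  exact this.isUnit

section
open scoped MatrixOrder Matrix.Norms.L2Operator

/-- A matrix of full column rank factors through a matrix with orthonormal columns. -/
theorem exists_orthonormal_factor {m n : ℕ} {A : Matrix (Fin m) (Fin n) ℝ}
    (hA : Function.Injective A.mulVec) :
    ∃ (U : Matrix (Fin m) (Fin n) ℝ) (J : Matrix (Fin n) (Fin n) ℝ),
      Uᵀ * U = 1 ∧ IsUnit J ∧ U * J = A := by
  have hpos := (posSemidef_conjTranspose_mul_self A).nonneg
  -- Any factorization `AᵀA = JᵀJ` with square `J` serves; then `U = A J⁻¹`.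
  obtain ⟨J, hJ⟩ := CStarAlgebra.nonneg_iff_eq_star_mul_self.mp hpos
  rw [star_eq_conjTranspose, conjTranspose_eq_transpose_of_trivial,
    conjTranspose_eq_transpose_of_trivial] at hJ
  have hJu : IsUnit J := by
    have h := isUnit_gram hA
    rw [hJ] at h
    rw [isUnit_iff_isUnit_det, det_mul] at h
    rw [isUnit_iff_isUnit_det]
    exact isUnit_of_mul_isUnit_right h
  have hdet := (isUnit_iff_isUnit_det J).1 hJu
  have hdetT : IsUnit Jᵀ.det := by rwa [det_transpose]
  refine ⟨A * J⁻¹, J, ?_, hJu, ?_⟩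
  · rw [transpose_mul, transpose_nonsing_inv, Matrix.mul_assoc, ← Matrix.mul_assoc Aᵀ, hJ,
      Matrix.mul_assoc, mul_nonsing_inv _ hdet, Matrix.mul_one, nonsing_inv_mul _ hdetT]
  · rw [Matrix.mul_assoc, nonsing_inv_mul _ hdet, Matrix.mul_one]

end

/-- Existence of one solution is enough for the choice defining `pinv`; the witness is `(AᵀA)⁻¹Aᵀ`.
-/
theorem isMoorePenrose_pinv {m n : ℕ} {A : Matrix (Fin m) (Fin n) ℝ}
    (hA : Function.Injective A.mulVec) : IsMoorePenrose A (pinv A) := by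
  have hdet := (isUnit_iff_isUnit_det _).1 (isUnit_gram hA)
  have hsymm : (Aᵀ * A)ᵀ = Aᵀ * A := by rw [transpose_mul, transpose_transpose]
  have hl : (Aᵀ * A)⁻¹ * Aᵀ * A = 1 := by rw [Matrix.mul_assoc, nonsing_inv_mul _ hdet]
  refine Classical.epsilon_spec (p := IsMoorePenrose A) ⟨(Aᵀ * A)⁻¹ * Aᵀ, ?_, ?_, ?_, ?_⟩
  · rw [Matrix.mul_assoc, hl, Matrix.mul_one]
  · rw [hl, Matrix.one_mul]
  · rw [transpose_mul, transpose_mul, transpose_transpose, transpose_nonsing_inv, hsymm,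
      Matrix.mul_assoc]
  · rw [hl, transpose_one]

theorem pinv_normal_equations {m n : ℕ} {A : Matrix (Fin m) (Fin n) ℝ}
    (hA : Function.Injective A.mulVec) (b : Fin m → ℝ) :
    Aᵀ *ᵥ (b - A *ᵥ (pinv A *ᵥ b)) = 0 := by
  have h := isMoorePenrose_pinv hA
  have : Aᵀ * (A * pinv A) = Aᵀ := by
    conv_lhs => rw [← h.symm_left, ← transpose_mul, h.mul_mul]
  rw [mulVec_sub, mulVec_mulVec, mulVec_mulVec, Matrix.mul_assoc, this, sub_self]

theorem eq_pinv_mulVec {m n : ℕ} {A : Matrix (Fin m) (Fin n) ℝ}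
    (hA : Function.Injective A.mulVec) {b : Fin m → ℝ} {x : Fin n → ℝ}
    (hx : Aᵀ *ᵥ (b - A *ᵥ x) = 0) : x = pinv A *ᵥ b := by
  apply mulVec_injective_of_isUnit (isUnit_gram hA)
  have h := pinv_normal_equations hA b
  rw [mulVec_sub, sub_eq_zero, mulVec_mulVec] at hx h
  exact hx.symm.trans h

theorem mulVec_mul_inv_injective {m n : ℕ} {A : Matrix (Fin m) (Fin n) ℝ}
    (hA : Function.Injective A.mulVec) {R : Matrix (Fin n) (Fin n) ℝ} (hR : IsUnit R) :
    Function.Injective (A * R⁻¹).mulVec := by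
  have h : (A * R⁻¹).mulVec = A.mulVec ∘ R⁻¹.mulVec := by
    funext x; simp [mulVec_mulVec]
  rw [h]
  exact hA.comp (mulVec_injective_of_isUnit ((isUnit_nonsing_inv_iff).2 hR))

/-- Right preconditioning does not change the least squares problem. -/
theorem pinv_mulVec_precondition {m n : ℕ} {A : Matrix (Fin m) (Fin n) ℝ}
    (hA : Function.Injective A.mulVec) {R : Matrix (Fin n) (Fin n) ℝ} (hR : IsUnit R)
    (b : Fin m → ℝ) : pinv A *ᵥ b = R⁻¹ *ᵥ (pinv (A * R⁻¹) *ᵥ b) := by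
  have hdet := (isUnit_iff_isUnit_det _).1 hR
  refine (eq_pinv_mulVec hA ?_).symm
  have h := pinv_normal_equations (mulVec_mul_inv_injective hA hR) b
  have h2 : Aᵀ = Rᵀ * (A * R⁻¹)ᵀ := by
    rw [← transpose_mul, Matrix.mul_assoc, nonsing_inv_mul _ hdet, Matrix.mul_one]
  rw [mulVec_mulVec, h2, ← mulVec_mulVec, h, mulVec_zero]

theorem energyNorm_gram {m n : ℕ} (A : Matrix (Fin m) (Fin n) ℝ) (x : Fin n → ℝ) :
    energyNorm (Aᵀ * A) x = l2norm (A *ᵥ x) := by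
  rw [energyNorm, dotProduct_gram, ← l2norm_sq, Real.sqrt_sq (l2norm_nonneg _)]

/-! ### Spectral estimates for the preconditioned problem. -/

/-- If `F` acts on every eigenvector of the symmetric matrix `H` as a scalar of absolute value at
most `C`, then the spectral norm of `F` is at most `C`. -/
theorem dotProduct_self_le_of_eigenvectors {n : ℕ} {H F : Matrix (Fin n) (Fin n) ℝ}
    (hH : Hᵀ = H) {f : ℝ → ℝ} {C : ℝ} (hF : ∀ a x, H *ᵥ x = a • x → F *ᵥ x = f a • x)
    (hC : ∀ a x, x ≠ 0 → H *ᵥ x = a • x → |f a| ≤ C) (x : Fin n → ℝ) :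
    (F *ᵥ x) ⬝ᵥ (F *ᵥ x) ≤ C ^ 2 * (x ⬝ᵥ x) := by
  have hherm : H.IsHermitian := by rwa [IsHermitian, conjTranspose_eq_transpose_of_trivial]
  set e := hherm.eigenvectorBasis
  set X : EuclideanSpace ℝ (Fin n) := WithLp.toLp 2 x with hX
  have hFe : ∀ i, toEuclideanLin F (e i) = f (hherm.eigenvalues i) • e i := by
    intro i
    have := hF _ _ (hherm.mulVec_eigenvectorBasis i)
    rw [toLpLin_apply]
    exact congrArg (WithLp.toLp 2) this
  have hinner : ∀ j, inner ℝ (e j) (toEuclideanLin F X) =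
      f (hherm.eigenvalues j) * inner ℝ (e j) X := by
    intro j
    conv_lhs => rw [← e.sum_repr X, map_sum, inner_sum]
    simp only [map_smul, hFe, inner_smul_right, e.inner_eq_ite, e.repr_apply_apply]
    simp [mul_comm]
  have h1 : (F *ᵥ x) ⬝ᵥ (F *ᵥ x) = ‖toEuclideanLin F X‖ ^ 2 := (l2norm_sq _).symm
  have h2 : x ⬝ᵥ x = ‖X‖ ^ 2 := (l2norm_sq _).symm
  rw [h1, h2, ← e.sum_sq_norm_inner_right, ← e.sum_sq_norm_inner_right X, Finset.mul_sum]
  refine Finset.sum_le_sum fun i _ => ?_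
  rw [hinner, norm_mul, mul_pow]
  refine mul_le_mul_of_nonneg_right ?_ (by positivity)
  refine pow_le_pow_left₀ (norm_nonneg _) (hC _ (e i).ofLp ?_ (hherm.mulVec_eigenvectorBasis i)) 2
  intro h0
  exact e.orthonormal.ne_zero i (by ext k; exact congrFun h0 k)

theorem pow_mulVec_of_eigenvector {n : ℕ} {F : Matrix (Fin n) (Fin n) ℝ} {a : ℝ}
    {x : Fin n → ℝ} (h : F *ᵥ x = a • x) (k : ℕ) : (F ^ k) *ᵥ x = a ^ k • x := by
  induction k with
  | zero => simp
  | succ k ih =>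
    rw [pow_succ, ← mulVec_mulVec, h, mulVec_smul, ih, smul_smul, mul_comm, ← pow_succ]

theorem dotProduct_mulVec_orthonormal {m n : ℕ} {U : Matrix (Fin m) (Fin n) ℝ} (hU : Uᵀ * U = 1)
    (x y : Fin n → ℝ) : (U *ᵥ x) ⬝ᵥ (U *ᵥ y) = x ⬝ᵥ y := by
  rw [← dotProduct_gram, hU, one_mulVec]

/-- Convergence of LSQR for `B = U T`, where `U` has orthonormal columns. -/
theorem lsqr_error_le {m n : ℕ} {U : Matrix (Fin m) (Fin n) ℝ} (hU : Uᵀ * U = 1)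
    (T : Matrix (Fin n) (Fin n) ℝ) {b : Fin m → ℝ} {y₀ z : Fin n → ℝ}
    (hz : (U * T)ᵀ *ᵥ (b - (U * T) *ᵥ z) = 0) (c : ℝ) (k : ℕ) :
    (T *ᵥ (lsqr (U * T) b y₀ k - z)) ⬝ᵥ (T *ᵥ (lsqr (U * T) b y₀ k - z)) ≤
      (((1 - c • (T * Tᵀ)) ^ k) *ᵥ (T *ᵥ (y₀ - z))) ⬝ᵥ
        (((1 - c • (T * Tᵀ)) ^ k) *ᵥ (T *ᵥ (y₀ - z))) := by
  have hgram : (U * T)ᵀ * (U * T) = Tᵀ * T := by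
    rw [transpose_mul, Matrix.mul_assoc, ← Matrix.mul_assoc Uᵀ, hU, Matrix.one_mul]
  -- Uses `T(1 - c TᵀT) = (1 - c T Tᵀ)T`.
  have hrich : ∀ k, T *ᵥ (richardson (U * T) b y₀ c k - z) =
      ((1 - c • (T * Tᵀ)) ^ k) *ᵥ (T *ᵥ (y₀ - z)) := by
    intro k
    induction k with
    | zero => simp [richardson]
    | succ k ih =>
      have hs : richardson (U * T) b y₀ c (k + 1) = richardson (U * T) b y₀ c k +
          c • ((U * T)ᵀ *ᵥ (b - (U * T) *ᵥ richardson (U * T) b y₀ c k)) := by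
        simp only [richardson, Function.iterate_succ_apply']
      rw [hs, pow_succ', ← mulVec_mulVec (T *ᵥ (y₀ - z)), ← ih]
      generalize richardson (U * T) b y₀ c k = x
      have e : b - (U * T) *ᵥ x = (b - (U * T) *ᵥ z) - (U * T) *ᵥ (x - z) := by
        rw [mulVec_sub (U * T)]; abel
      rw [e, mulVec_sub (U * T)ᵀ, hz, zero_sub, mulVec_mulVec, hgram, add_sub_right_comm, mulVec_add,
        mulVec_smul, mulVec_neg, sub_mulVec, one_mulVec, smul_mulVec, mulVec_mulVec, mulVec_mulVec,
        Matrix.mul_assoc, smul_neg, ← sub_eq_add_neg]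
  -- The residual splits orthogonally at the minimizer `z`, so comparing residuals compares errors.
  have hpyth : ∀ y, (b - (U * T) *ᵥ y) ⬝ᵥ (b - (U * T) *ᵥ y) =
      (b - (U * T) *ᵥ z) ⬝ᵥ (b - (U * T) *ᵥ z) + (T *ᵥ (y - z)) ⬝ᵥ (T *ᵥ (y - z)) := by
    intro y
    have e : b - (U * T) *ᵥ y = (b - (U * T) *ᵥ z) - (U * T) *ᵥ (y - z) := by
      rw [mulVec_sub (U * T)]; abel
    have horth : (b - (U * T) *ᵥ z) ⬝ᵥ ((U * T) *ᵥ (y - z)) = 0 := by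
      rw [dotProduct_mulVec, ← mulVec_transpose, hz, zero_dotProduct]
    have hnorm : ((U * T) *ᵥ (y - z)) ⬝ᵥ ((U * T) *ᵥ (y - z)) =
        (T *ᵥ (y - z)) ⬝ᵥ (T *ᵥ (y - z)) := by
      rw [← mulVec_mulVec, dotProduct_mulVec_orthonormal hU]
    rw [e]
    generalize b - (U * T) *ᵥ z = r at *
    rw [sub_dotProduct, dotProduct_sub, dotProduct_sub,
      dotProduct_comm ((U * T) *ᵥ (y - z)) r, horth, hnorm]
    ring
  have h := lsqr_residual_le (U * T) b y₀ c k
  rw [hpyth, hpyth (richardson _ _ _ _ _), hrich] at h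
  linarith

/-- If `S` embeds the range of `U` with distortion `μ < 1`, then the triangular factor of a QR
factorization of `S U J` is invertible. -/
theorem isUnit_of_embedding {m n s : ℕ} {S : Matrix (Fin s) (Fin m) ℝ}
    {U : Matrix (Fin m) (Fin n) ℝ} {J R : Matrix (Fin n) (Fin n) ℝ} {Q : Matrix (Fin s) (Fin n) ℝ}
    (hJ : IsUnit J) (hQR : IsQR (S * (U * J)) Q R) {μ : ℝ} (hμ : μ < 1)
    (hS : ∀ x, |(S * U) *ᵥ x ⬝ᵥ (S * U) *ᵥ x - x ⬝ᵥ x| ≤ μ * (x ⬝ᵥ x)) : IsUnit R := by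
  rw [← mulVec_injective_iff_isUnit]
  have hker : ∀ x, R *ᵥ x = 0 → x = 0 := by
    intro x hx
    have h1 : (S * U) *ᵥ (J *ᵥ x) = 0 := by
      rw [mulVec_mulVec, Matrix.mul_assoc, ← hQR.factor, ← mulVec_mulVec, hx, mulVec_zero]
    have h2 := hS (J *ᵥ x)
    rw [h1, zero_dotProduct, zero_sub, abs_neg, ← l2norm_sq, abs_of_nonneg (by positivity)] at h2
    have h3 : J *ᵥ x = 0 := by
      rw [← l2norm_eq_zero]
      by_contra h0
      have : 0 < l2norm (J *ᵥ x) ^ 2 := by positivity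
      nlinarith
    exact mulVec_injective_of_isUnit hJ (h3.trans (mulVec_zero J).symm)
  intro x y hxy
  refine sub_eq_zero.1 (hker _ ?_)
  rw [mulVec_sub]; exact sub_eq_zero.2 hxy

/-- The matrix `T Tᵀ` of the preconditioned problem inverts the sketched Gram matrix. -/
theorem precondition_mul_gram {m n s : ℕ} {S : Matrix (Fin s) (Fin m) ℝ}
    {U : Matrix (Fin m) (Fin n) ℝ} {J R : Matrix (Fin n) (Fin n) ℝ} {Q : Matrix (Fin s) (Fin n) ℝ}
    (hQR : IsQR (S * (U * J)) Q R) (hR : IsUnit R) :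
    S * U * (J * R⁻¹) = Q ∧
      ((S * U)ᵀ * (S * U)) * ((J * R⁻¹) * (J * R⁻¹)ᵀ) = 1 := by
  have hdet := (isUnit_iff_isUnit_det _).1 hR
  have hQ : S * U * (J * R⁻¹) = Q := by
    rw [← Matrix.mul_assoc, Matrix.mul_assoc S, ← hQR.factor, Matrix.mul_assoc,
      mul_nonsing_inv _ hdet, Matrix.mul_one]
  refine ⟨hQ, ?_⟩
  have h1 : (J * R⁻¹)ᵀ * ((S * U)ᵀ * (S * U) * (J * R⁻¹)) = 1 := by
    rw [Matrix.mul_assoc, hQ, ← Matrix.mul_assoc, ← transpose_mul, hQ, hQR.orthonormal]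
  rw [← Matrix.mul_assoc]
  exact mul_eq_one_comm.1 h1

/-- The eigenvalues of the inverse of a near-identity Gram matrix. -/
theorem eigenvalue_of_gram_inverse {s n : ℕ} {V : Matrix (Fin s) (Fin n) ℝ}
    {H : Matrix (Fin n) (Fin n) ℝ} (hH : (Vᵀ * V) * H = 1) {μ : ℝ}
    (hV : ∀ x, |V *ᵥ x ⬝ᵥ V *ᵥ x - x ⬝ᵥ x| ≤ μ * (x ⬝ᵥ x)) {a : ℝ} {x : Fin n → ℝ} (hx : x ≠ 0)
    (ha : H *ᵥ x = a • x) : ∃ ν, a * ν = 1 ∧ |ν - 1| ≤ μ := by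
  have h1 : x = a • ((Vᵀ * V) *ᵥ x) := by
    rw [← mulVec_smul, ← ha, mulVec_mulVec, hH, one_mulVec]
  have h2 : x ⬝ᵥ x = a * (V *ᵥ x ⬝ᵥ V *ᵥ x) := by
    conv_lhs => rw [h1, smul_dotProduct, smul_eq_mul, dotProduct_comm, ← h1, dotProduct_gram]
  have h3 : 0 < x ⬝ᵥ x := by
    rw [← l2norm_sq]
    have := l2norm_eq_zero.not.2 hx
    positivity
  -- `ν` is the Rayleigh quotient of `VᵀV` at `x`.
  refine ⟨(V *ᵥ x ⬝ᵥ V *ᵥ x) / (x ⬝ᵥ x), by rw [← mul_div_assoc, ← h2, div_self h3.ne'], ?_⟩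
  rw [div_sub_one h3.ne', abs_div, abs_of_pos h3, div_le_iff₀ h3]
  exact hV x

/-! ### Distortion of a subspace by the sketch. -/

theorem sketchError_mulVec {s m n : ℕ} (ω : CountSketchSeed s m) (U : Matrix (Fin m) (Fin n) ℝ)
    (x : Fin n → ℝ) (z : Fin m → ℝ) :
    sketchError ω (U *ᵥ x) z = ∑ a, x a * sketchError ω (Uᵀ a) z := by
  have h : U *ᵥ x = ∑ a, x a • Uᵀ a := by
    rw [mulVec_eq_sum]; simp
  simp only [sketchError, h, mulVec_sum, sum_dotProduct, mulVec_smul, smul_dotProduct, smul_eq_mul,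
    mul_sub, Finset.sum_sub_distrib]

theorem sketchError_comm {s m : ℕ} (ω : CountSketchSeed s m) (x y : Fin m → ℝ) :
    sketchError ω x y = sketchError ω y x := by
  rw [sketchError, sketchError, dotProduct_comm, dotProduct_comm x]

/-- The squared Frobenius norm of `(S U)ᵀ (S U) - Uᵀ U`. -/
def sketchDefect {s m n : ℕ} (ω : CountSketchSeed s m) (U : Matrix (Fin m) (Fin n) ℝ) : ℝ :=
  ∑ a, ∑ b, sketchError ω (Uᵀ a) (Uᵀ b) ^ 2

theorem sketchDefect_nonneg {s m n : ℕ} (ω : CountSketchSeed s m)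
    (U : Matrix (Fin m) (Fin n) ℝ) : 0 ≤ sketchDefect ω U :=
  Finset.sum_nonneg fun _ _ => Finset.sum_nonneg fun _ _ => sq_nonneg _

/-- The Frobenius norm dominates the spectral norm, by Cauchy–Schwarz over pairs of columns. -/
theorem embedding_of_sketchDefect {s m n : ℕ} {ω : CountSketchSeed s m}
    {U : Matrix (Fin m) (Fin n) ℝ} (hU : Uᵀ * U = 1) {μ : ℝ} (hμ : √(sketchDefect ω U) ≤ μ)
    (x : Fin n → ℝ) :
    |(countSketch ω * U) *ᵥ x ⬝ᵥ (countSketch ω * U) *ᵥ x - x ⬝ᵥ x| ≤ μ * (x ⬝ᵥ x) := by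
  have hx : 0 ≤ x ⬝ᵥ x := by rw [← l2norm_sq]; positivity
  have h1 : (countSketch ω * U) *ᵥ x ⬝ᵥ (countSketch ω * U) *ᵥ x - x ⬝ᵥ x =
      ∑ p : Fin n × Fin n, (x p.1 * x p.2) * sketchError ω (Uᵀ p.1) (Uᵀ p.2) := by
    rw [← mulVec_mulVec, ← dotProduct_mulVec_orthonormal hU x x]
    change sketchError ω (U *ᵥ x) (U *ᵥ x) = _
    rw [sketchError_mulVec, Fintype.sum_prod_type]
    refine Finset.sum_congr rfl fun a _ => ?_
    rw [sketchError_comm, sketchError_mulVec, Finset.mul_sum]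
    refine Finset.sum_congr rfl fun b _ => ?_
    rw [sketchError_comm]; ring
  have h2 : ∑ p : Fin n × Fin n, (x p.1 * x p.2) ^ 2 = (x ⬝ᵥ x) ^ 2 := by
    rw [Fintype.sum_prod_type, sq (x ⬝ᵥ x), dotProduct, Finset.sum_mul_sum]
    exact Finset.sum_congr rfl fun a _ => Finset.sum_congr rfl fun b _ => by ring
  have h3 := Finset.sum_mul_sq_le_sq_mul_sq Finset.univ
    (fun p : Fin n × Fin n => x p.1 * x p.2) fun p => sketchError ω (Uᵀ p.1) (Uᵀ p.2)
  have h4 : ∑ p : Fin n × Fin n, sketchError ω (Uᵀ p.1) (Uᵀ p.2) ^ 2 = sketchDefect ω U := by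
    rw [Fintype.sum_prod_type]; rfl
  rw [← h1, h2, h4] at h3
  refine le_trans ?_ (mul_le_mul_of_nonneg_right hμ hx)
  apply abs_le_of_sq_le_sq _ (by positivity)
  rw [mul_pow, Real.sq_sqrt (sketchDefect_nonneg ω U), mul_comm]
  exact h3

/-- Each of the `n²` pairs of columns contributes at most `1/s`, and each of the `n` diagonal pairs
another `1/s`. -/
theorem sum_sketchDefect_le {s m n : ℕ} [NeZero s] {U : Matrix (Fin m) (Fin n) ℝ}
    (hU : Uᵀ * U = 1) : ∑ ω : CountSketchSeed s m, sketchDefect ω U ≤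
      Fintype.card (CountSketchSeed s m) * (((n : ℝ) ^ 2 + n) / s) := by
  have hdot : ∀ a b, Uᵀ a ⬝ᵥ Uᵀ b = if a = b then 1 else 0 := fun a b => by
    rw [← Matrix.one_apply, ← hU]; rfl
  calc _ = ∑ a, ∑ b, ∑ ω : CountSketchSeed s m, sketchError ω (Uᵀ a) (Uᵀ b) ^ 2 := by
        simp only [sketchDefect]
        rw [Finset.sum_comm]
        exact Finset.sum_congr rfl fun a _ => Finset.sum_comm
    _ ≤ ∑ a : Fin n, ∑ b : Fin n, Fintype.card (CountSketchSeed s m) *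
          ((1 + if a = b then 1 else 0) / (s : ℝ)) := by
        refine Finset.sum_le_sum fun a _ => Finset.sum_le_sum fun b _ => ?_
        refine (sum_sketchError_sq_le (Uᵀ a) (Uᵀ b)).trans_eq ?_
        rw [hdot, hdot, hdot, if_pos rfl, if_pos rfl]
        split_ifs <;> ring
    _ = _ := by
        simp only [← Finset.mul_sum, ← Finset.sum_div, Finset.sum_add_distrib]
        simp
        left; ring

/-- Bounds the mean of `‖g‖²`, where `g` is the sketched correlation of the range of `U` with the
residual direction. -/
theorem sum_sketchError_columns_le {s m n : ℕ} [NeZero s] {U : Matrix (Fin m) (Fin n) ℝ}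
    (hU : Uᵀ * U = 1) {r : Fin m → ℝ} (hr : r ⬝ᵥ r ≤ 1) (horth : ∀ a, Uᵀ a ⬝ᵥ r = 0) :
    ∑ ω : CountSketchSeed s m, ∑ a, sketchError ω (Uᵀ a) r ^ 2 ≤
      Fintype.card (CountSketchSeed s m) * ((n : ℝ) / s) := by
  have hdot : ∀ a, Uᵀ a ⬝ᵥ Uᵀ a = 1 := fun a => by
    rw [← Matrix.one_apply_eq (α := ℝ) a, ← hU]; rfl
  rw [Finset.sum_comm]
  calc _ ≤ ∑ a : Fin n, Fintype.card (CountSketchSeed s m) * (1 / (s : ℝ)) := by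
        refine Finset.sum_le_sum fun a _ => (sum_sketchError_sq_le (Uᵀ a) r).trans ?_
        rw [hdot, horth]
        gcongr
        linarith
    _ = _ := by simp; ring

/-! ### Iteration counts and the estimates at a good seed. -/

/-- The requirement on the number of iterations, without logarithms. -/
theorem pow_le_of_iterations {ε τ : ℝ} (hε : 0 < ε ∧ ε < 1) (hτ : 0 < τ) {k : ℕ}
    (hk : (Real.log 2 + |Real.log τ|) / |Real.log ε| ≤ k) : ε ^ k ≤ τ ∧ ε ^ k ≤ 1 / 2 := by
  have hlog : Real.log ε < 0 := Real.log_neg hε.1 hε.2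
  rw [abs_of_neg hlog, div_le_iff₀ (neg_pos.2 hlog)] at hk
  have h2 : 0 < Real.log 2 := Real.log_pos (by norm_num)
  have hpos : 0 < ε ^ k := pow_pos hε.1 k
  constructor
  · rw [← Real.log_le_log_iff hpos hτ, Real.log_pow]
    linarith [neg_abs_le (Real.log τ)]
  · rw [← Real.log_le_log_iff hpos (by norm_num), Real.log_pow, one_div, Real.log_inv]
    linarith [abs_nonneg (Real.log τ)]

/-- `z(1 - z)^k ≤ z e^{-kz} ≤ 1/(2k)`, while `k(1/ε - 1) ≥ k ln(1/ε) ≥ ln 2 ≥ 1/2`. -/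
theorem mul_one_sub_pow_le {ε z : ℝ} (hε : 0 < ε ∧ ε < 1) {k : ℕ} (hk : ε ^ k ≤ 1 / 2)
    (hz : 0 ≤ z) (hz1 : z ≤ 1) : z * (1 - z) ^ k ≤ 1 / ε - 1 := by
  have hk0 : (0 : ℝ) < k := by
    rcases Nat.eq_zero_or_pos k with rfl | h
    · norm_num at hk
    · exact_mod_cast h
  have h1 : 1 / 2 ≤ k * (1 / ε - 1) := by
    have hlog : Real.log (1 / ε) ≤ 1 / ε - 1 :=
      Real.log_le_sub_one_of_pos (one_div_pos.2 hε.1)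
    have h2 : Real.log 2 ≤ k * Real.log (1 / ε) := by
      rw [← Real.log_pow]
      refine Real.log_le_log (by norm_num) ?_
      rw [div_pow, one_pow, le_div_iff₀ (pow_pos hε.1 k)]
      linarith
    have h3 := Real.log_two_gt_d9
    have h4 := mul_le_mul_of_nonneg_left hlog hk0.le
    linarith
  have h2 : (1 - z) ^ k ≤ Real.exp (-(k * z)) := by
    calc (1 - z) ^ k ≤ Real.exp (-z) ^ k :=
          pow_le_pow_left₀ (by linarith) (Real.one_sub_le_exp_neg z) k
      _ = _ := by rw [← Real.exp_nat_mul]; ring_nf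
  have h3 : (k * z) * Real.exp (-(k * z)) ≤ 1 / 2 := by
    have hy : 0 ≤ k * z := by positivity
    generalize (k : ℝ) * z = y at hy
    have := Real.quadratic_le_exp_of_nonneg hy
    rw [Real.exp_neg, ← div_eq_mul_inv, div_le_iff₀ (Real.exp_pos y)]
    nlinarith [sq_nonneg (y - 1)]
  have h4 : k * (z * (1 - z) ^ k) ≤ k * (1 / ε - 1) := by
    calc k * (z * (1 - z) ^ k) = (k * z) * (1 - z) ^ k := by ring
      _ ≤ (k * z) * Real.exp (-(k * z)) := by gcongr
      _ ≤ _ := h3.trans h1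
  exact le_of_mul_le_mul_left h4 hk0

theorem one_sub_smul_mulVec_of_eigenvector {n : ℕ} {H : Matrix (Fin n) (Fin n) ℝ} {a c : ℝ}
    {x : Fin n → ℝ} (h : H *ᵥ x = a • x) : (1 - c • H) *ᵥ x = (1 - c * a) • x := by
  rw [sub_mulVec, one_mulVec, smul_mulVec, h]; module

/-- LSQR started at zero, with a sketched preconditioner of distortion less than `ε`. -/
theorem lsqr_zero_error_le {m n s : ℕ} {ω : CountSketchSeed s m} {U : Matrix (Fin m) (Fin n) ℝ}
    {J R : Matrix (Fin n) (Fin n) ℝ} {Q : Matrix (Fin s) (Fin n) ℝ} (hU : Uᵀ * U = 1)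
    (hJ : IsUnit J) (hQR : IsQR (countSketch ω * (U * J)) Q R) {ε : ℝ} (hε : 0 < ε ∧ ε < 1)
    (hω : sketchDefect ω U < ε ^ 2) {b : Fin m → ℝ} {z : Fin n → ℝ}
    (hz : (U * J * R⁻¹)ᵀ *ᵥ (b - (U * J * R⁻¹) *ᵥ z) = 0) (k : ℕ) :
    l2norm ((U * J * R⁻¹) *ᵥ (lsqr (U * J * R⁻¹) b 0 k - z)) ≤
      ε ^ k * l2norm ((U * J * R⁻¹) *ᵥ z) := by
  have hemb := embedding_of_sketchDefect hU
    ((Real.sqrt_le_sqrt hω.le).trans_eq (Real.sqrt_sq hε.1.le))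
  have hR := isUnit_of_embedding hJ hQR hε.2 hemb
  have hH := (precondition_mul_gram hQR hR).2
  rw [Matrix.mul_assoc] at hz ⊢
  set T := J * R⁻¹
  have hnorm : ∀ y, l2norm ((U * T) *ᵥ y) ^ 2 = (T *ᵥ y) ⬝ᵥ (T *ᵥ y) := fun y => by
    rw [l2norm_sq, ← mulVec_mulVec, dotProduct_mulVec_orthonormal hU]
  -- With `c = 1 - ε²`, the factor `1 - c/ν` runs from `-ε` to `ε` as `ν` runs from `1 - ε` to `1 +
  -- ε`.
  have hmain := lsqr_error_le hU T (y₀ := 0) hz (1 - ε ^ 2) k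
  have hspec := dotProduct_self_le_of_eigenvectors (H := T * Tᵀ)
    (F := (1 - (1 - ε ^ 2) • (T * Tᵀ)) ^ k) (f := fun a => (1 - (1 - ε ^ 2) * a) ^ k)
    (C := ε ^ k) (by rw [transpose_mul, transpose_transpose])
    (fun a x h => pow_mulVec_of_eigenvector (one_sub_smul_mulVec_of_eigenvector h) k)
    (fun a x hx h => by
      obtain ⟨ν, hν, hν1⟩ := eigenvalue_of_gram_inverse hH hemb hx h
      rw [abs_pow]
      refine pow_le_pow_left₀ (abs_nonneg _) ?_ k
      rw [abs_le] at hν1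
      have hν0 : 0 < ν := by linarith [hε.2]
      have ha : a = 1 / ν := by rw [eq_div_iff hν0.ne', hν]
      have he : 1 - (1 - ε ^ 2) * a = (ν - (1 - ε ^ 2)) / ν := by
        rw [ha]; field_simp
      rw [he, abs_div, abs_of_pos hν0, div_le_iff₀ hν0, abs_le]
      constructor <;> nlinarith [hε.1, hε.2]) (T *ᵥ (0 - z))
  refine le_of_sq_le_sq ?_ (mul_nonneg (pow_nonneg hε.1.le k) (l2norm_nonneg _))
  rw [mul_pow, hnorm, hnorm]
  refine hmain.trans (hspec.trans_eq ?_)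
  rw [zero_sub, mulVec_neg, neg_dotProduct_neg]

/-- LSQR started at the solution of the sketched problem, at a seed for which the distortion of
the range of `U` and of the direction of the optimal residual are jointly small. -/
theorem lsqr_sketch_residual_le {m n s : ℕ} {ω : CountSketchSeed s m}
    {U : Matrix (Fin m) (Fin n) ℝ} {J R : Matrix (Fin n) (Fin n) ℝ}
    {Q : Matrix (Fin s) (Fin n) ℝ} (hU : Uᵀ * U = 1)
    (hQR : IsQR (countSketch ω * (U * J)) Q R) (hR : IsUnit R) {ε : ℝ} (hε : 0 < ε ∧ ε < 1)
    {b : Fin m → ℝ} {z : Fin n → ℝ} {k : ℕ} (hk : ε ^ k ≤ 1 / 2)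
    {r : Fin m → ℝ} (hr : b - (U * J * R⁻¹) *ᵥ z = r)
    (horth : ∀ a, Uᵀ a ⬝ᵥ unitize r = 0)
    (hω : sketchDefect ω U + (1 / ε - 1) * ∑ a, sketchError ω (Uᵀ a) (unitize r) ^ 2 < ε) :
    l2norm ((U * J * R⁻¹) *ᵥ
      lsqr (U * J * R⁻¹) b (Qᵀ *ᵥ (countSketch ω *ᵥ b)) k - b) ^ 2 ≤ 2 * l2norm r ^ 2 := by
  set S := countSketch ω
  set μ := √(sketchDefect ω U) with hμ
  set g : Fin n → ℝ := (S * U)ᵀ *ᵥ (S *ᵥ unitize r) with hg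
  set t := 1 / ε - 1 with ht
  have ht0 : 0 < t := sub_pos.2 ((one_lt_div hε.1).2 hε.2)
  have hgsq : g ⬝ᵥ g = ∑ a, sketchError ω (Uᵀ a) (unitize r) ^ 2 := by
    refine Finset.sum_congr rfl fun a _ => ?_
    rw [sketchError, horth, sub_zero, sq]
    have : g a = (S *ᵥ Uᵀ a) ⬝ᵥ (S *ᵥ unitize r) := rfl
    rw [this]
  have hμ2 : μ ^ 2 = sketchDefect ω U := Real.sq_sqrt (sketchDefect_nonneg ω U)
  have hsum : μ + t * l2norm g < 1 := by
    rw [← hμ2, ← hgsq, ← l2norm_sq] at hω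
    -- Cauchy–Schwarz with weights `1` and `t`; the gap is `t(μ - ‖g‖)²`. The weight makes `1 + t =
    -- 1/ε`.
    have h1 : (μ + t * l2norm g) ^ 2 ≤ (1 + t) * (μ ^ 2 + t * l2norm g ^ 2) := by
      nlinarith [mul_nonneg ht0.le (sq_nonneg (μ - l2norm g))]
    have h2 : (1 + t) * (μ ^ 2 + t * l2norm g ^ 2) < 1 := by
      have : 1 + t = 1 / ε := by rw [ht]; ring
      rw [this, one_div_mul_eq_div, div_lt_one hε.1]
      exact hω
    have h3 := h1.trans_lt h2
    exact lt_of_pow_lt_pow_left₀ 2 zero_le_one (by simpa using h3)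
  have hgn := l2norm_nonneg g
  have hμ1 : μ < 1 := by nlinarith
  have hemb := embedding_of_sketchDefect hU hμ.symm.le
  obtain ⟨hQ, hH⟩ := precondition_mul_gram hQR hR
  rw [Matrix.mul_assoc] at hr ⊢
  set T := J * R⁻¹ with hT
  have hUr : Uᵀ *ᵥ r = 0 := by
    rw [← l2norm_smul_unitize r, mulVec_smul]
    have : Uᵀ *ᵥ unitize r = 0 := funext horth
    rw [this, smul_zero]
  have hBr : (U * T)ᵀ *ᵥ r = 0 := by
    rw [transpose_mul, ← mulVec_mulVec, hUr, mulVec_zero]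
  have hz : (U * T)ᵀ *ᵥ (b - (U * T) *ᵥ z) = 0 := by rw [hr, hBr]
  set y₀ := Qᵀ *ᵥ (S *ᵥ b) with hy₀
  -- Since `QᵀQ = 1`, `y₀ - z = Qᵀ S r`, and `Q = S U T`.
  have hstart : T *ᵥ (y₀ - z) = (T * Tᵀ) *ᵥ (l2norm r • g) := by
    have hb : b = (U * T) *ᵥ z + r := by rw [← hr]; abel
    have h1 : y₀ = z + Qᵀ *ᵥ (S *ᵥ r) := by
      rw [hy₀, hb, mulVec_add, mulVec_add, mulVec_mulVec z S, ← Matrix.mul_assoc, hQ,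
        mulVec_mulVec z, hQR.orthonormal, one_mulVec]
    have h2 : Qᵀ *ᵥ (S *ᵥ r) = Tᵀ *ᵥ (l2norm r • g) := by
      rw [hg, ← mulVec_smul, ← mulVec_smul, l2norm_smul_unitize, ← hQ, transpose_mul,
        mulVec_mulVec _ Tᵀ]
    rw [h1, add_sub_cancel_left, h2, mulVec_mulVec]
  -- The step `1 - μ` keeps `(1 - μ)a` in `[0, 1]` for all eigenvalues `a ≤ 1/(1 - μ)`, as
  -- `mul_one_sub_pow_le` needs.
  have hmain := lsqr_error_le hU T (y₀ := y₀) hz (1 - μ) k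
  rw [hstart, mulVec_mulVec] at hmain
  have hspec := dotProduct_self_le_of_eigenvectors (H := T * Tᵀ)
    (F := (1 - (1 - μ) • (T * Tᵀ)) ^ k * (T * Tᵀ)) (f := fun a => a * (1 - (1 - μ) * a) ^ k)
    (C := t / (1 - μ)) (by rw [transpose_mul, transpose_transpose])
    (fun a x h => by
      rw [← mulVec_mulVec, h, mulVec_smul,
        pow_mulVec_of_eigenvector (one_sub_smul_mulVec_of_eigenvector h) k, smul_smul])
    (fun a x hx h => by
      obtain ⟨ν, hν, hν1⟩ := eigenvalue_of_gram_inverse hH hemb hx h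
      rw [abs_le] at hν1
      have hν0 : 0 < ν := by linarith
      have ha : a = 1 / ν := by rw [eq_div_iff hν0.ne', hν]
      have ha0 : 0 < a := by rw [ha]; positivity
      have hz1 : (1 - μ) * a ≤ 1 := by rw [← hν, mul_comm]; nlinarith
      have := mul_one_sub_pow_le hε hk (z := (1 - μ) * a)
        (mul_nonneg (by linarith) ha0.le) hz1
      rw [abs_of_nonneg (mul_nonneg ha0.le (pow_nonneg (by linarith) k)),
        le_div_iff₀ (by linarith)]
      linarith) (l2norm r • g)
  have herr := hmain.trans hspec
  have hfinal : (t / (1 - μ)) ^ 2 * ((l2norm r • g) ⬝ᵥ (l2norm r • g)) ≤ l2norm r ^ 2 := by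
    have h1 : t * l2norm g / (1 - μ) ≤ 1 := by
      rw [div_le_one (by linarith)]; linarith
    have h2 : (t * l2norm g / (1 - μ)) ^ 2 ≤ 1 :=
      pow_le_one₀ (div_nonneg (by positivity) (by linarith)) h1
    calc _ = l2norm r ^ 2 * (t * l2norm g / (1 - μ)) ^ 2 := by
          rw [smul_dotProduct, dotProduct_smul, ← l2norm_sq, smul_eq_mul, smul_eq_mul]; ring
      _ ≤ l2norm r ^ 2 * 1 := by gcongr
      _ = _ := mul_one _
  set y := lsqr (U * T) b y₀ k
  have e : (U * T) *ᵥ y - b = U *ᵥ (T *ᵥ (y - z)) - r := by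
    rw [mulVec_mulVec, mulVec_sub, ← hr]; abel
  have hcross : (U *ᵥ (T *ᵥ (y - z))) ⬝ᵥ r = 0 := by
    rw [dotProduct_comm, dotProduct_mulVec, ← mulVec_transpose, hUr, zero_dotProduct]
  rw [e, l2norm_sq, sub_dotProduct, dotProduct_sub, dotProduct_sub, dotProduct_comm r, hcross,
    dotProduct_mulVec_orthonormal hU, ← l2norm_sq r]
  linarith

/-! ### Probability of the good seeds. -/

theorem theorem3p3 {m n s : ℕ} (hn : 0 < n) (A : Matrix (Fin m) (Fin n) ℝ) (hA : A.rank = n)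
    (b : Fin m → ℝ) (ε δ : ℝ) (hε : 0 < ε ∧ ε < 1) (hδ : 0 < δ ∧ δ < 1)
    (hs : ((n : ℝ) ^ 2 + n) / (δ * ε ^ 2) ≤ s)
    (τ : ℝ) (hτ : 0 < τ) (k : ℕ)
    (hk : (Real.log 2 + |Real.log τ|) / |Real.log ε| ≤ k) :
    -- the error estimate for the initial guess zero, in the preconditioned variable
    1 - δ ≤ (countSketchLaw s m).real
      {ω | ∀ Q R, IsQR (countSketch ω * A) Q R →
        IsUnit R ∧
        energyNorm ((A * R⁻¹)ᵀ * (A * R⁻¹)) (lsqr (A * R⁻¹) b 0 k - pinv (A * R⁻¹) *ᵥ b) ≤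
          τ * energyNorm ((A * R⁻¹)ᵀ * (A * R⁻¹)) (pinv (A * R⁻¹) *ᵥ b)} ∧
    -- whenever `R` is invertible, `x⋆ = R⁻¹ y⋆`, and that estimate is equivalent to the one in
    -- the original variable
    (∀ (ω : CountSketchSeed s m) (Q : Matrix (Fin s) (Fin n) ℝ) (R : Matrix (Fin n) (Fin n) ℝ),
      IsQR (countSketch ω * A) Q R → IsUnit R →
        pinv A *ᵥ b = R⁻¹ *ᵥ (pinv (A * R⁻¹) *ᵥ b) ∧
        (energyNorm ((A * R⁻¹)ᵀ * (A * R⁻¹)) (lsqr (A * R⁻¹) b 0 k - pinv (A * R⁻¹) *ᵥ b) ≤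
            τ * energyNorm ((A * R⁻¹)ᵀ * (A * R⁻¹)) (pinv (A * R⁻¹) *ᵥ b) ↔
          energyNorm (Aᵀ * A) (R⁻¹ *ᵥ lsqr (A * R⁻¹) b 0 k - pinv A *ᵥ b) ≤
            τ * energyNorm (Aᵀ * A) (pinv A *ᵥ b))) ∧
    -- the residual estimate for the initial guess `Qᵀ S b`
    1 - δ ≤ (countSketchLaw s m).real
      {ω | ∀ Q R, IsQR (countSketch ω * A) Q R →
        IsUnit R ∧
        l2norm (A *ᵥ (R⁻¹ *ᵥ lsqr (A * R⁻¹) b (Qᵀ *ᵥ (countSketch ω *ᵥ b)) k) - b) ≤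
          √(2 * (4 * τ ^ 2 / (1 - ε) + 1)) * l2norm (A *ᵥ (pinv A *ᵥ b) - b)} := by
  have hinj := mulVec_injective_of_rank_eq hA
  obtain ⟨U, J, hU, hJ, hUJ⟩ := exists_orthonormal_factor hinj
  have hn' : (0 : ℝ) < n := by exact_mod_cast hn
  have hε0 := hε.1
  have hδ0 := hδ.1
  have hs0 : (0 : ℝ) < s := lt_of_lt_of_le (by positivity) hs
  have : NeZero s := ⟨by rintro rfl; simp at hs0⟩
  have hmom : ((n : ℝ) ^ 2 + n) / s ≤ δ * ε ^ 2 := by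
    rw [div_le_iff₀ (by positivity)] at hs
    rw [div_le_iff₀ hs0]; linarith
  obtain ⟨hkτ, hk2⟩ := pow_le_of_iterations hε hτ hk
  refine ⟨?_, ?_, ?_⟩
  · refine countSketchLaw_real_ge (fun ω => sketchDefect ω U)
      (fun ω => sketchDefect_nonneg ω U) (pow_pos hε0 2) hmom (sum_sketchDefect_le hU) _ ?_
    intro ω hω Q R hQR
    have hQR' : IsQR (countSketch ω * (U * J)) Q R := by rwa [hUJ]
    have hR := isUnit_of_embedding hJ hQR' hε.2 (embedding_of_sketchDefect hU
      ((Real.sqrt_le_sqrt hω.le).trans_eq (Real.sqrt_sq hε.1.le)))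
    refine ⟨hR, ?_⟩
    have hz := pinv_normal_equations (mulVec_mul_inv_injective hinj hR) b
    rw [energyNorm_gram, energyNorm_gram]
    rw [← hUJ] at hz ⊢
    refine (lsqr_zero_error_le hU hJ hQR' hε hω hz k).trans ?_
    exact mul_le_mul_of_nonneg_right hkτ (l2norm_nonneg _)
  · intro ω Q R _ hR
    have hx := pinv_mulVec_precondition hinj hR b
    refine ⟨hx, ?_⟩
    simp only [energyNorm_gram]
    rw [hx, ← mulVec_sub, mulVec_mulVec _ A, mulVec_mulVec _ A]
  · set r := b - A *ᵥ (pinv A *ᵥ b) with hr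
    have ht : 0 ≤ 1 / ε - 1 := (sub_pos.2 ((one_lt_div hε.1).2 hε.2)).le
    have hJT : IsUnit Jᵀ := by
      rw [isUnit_iff_isUnit_det, det_transpose]
      exact (isUnit_iff_isUnit_det J).1 hJ
    have horth : ∀ a, Uᵀ a ⬝ᵥ unitize r = 0 := by
      have h1 : Jᵀ *ᵥ (Uᵀ *ᵥ r) = 0 := by
        rw [mulVec_mulVec, ← transpose_mul, hUJ]
        exact pinv_normal_equations hinj b
      have h2 : Uᵀ *ᵥ r = 0 := mulVec_injective_of_isUnit hJT (h1.trans (mulVec_zero _).symm)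
      have h3 : Uᵀ *ᵥ unitize r = 0 := by rw [unitize, mulVec_smul, h2, smul_zero]
      exact fun a => congrFun h3 a
    have hunit : unitize r ⬝ᵥ unitize r ≤ 1 := by
      by_cases h0 : l2norm r = 0
      · rw [unitize_eq_zero h0, zero_dotProduct]; exact zero_le_one
      · exact (unitize_dotProduct_self h0).le
    -- Both means are at most `δ ε²` and the weights add up to `1/ε`, so the mean is at most `δ ε`,
    -- which fits the Markov threshold `ε`.
    have hsum : ∑ ω : CountSketchSeed s m, (sketchDefect ω U +
        (1 / ε - 1) * ∑ a, sketchError ω (Uᵀ a) (unitize r) ^ 2) ≤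
        Fintype.card (CountSketchSeed s m) * (δ * ε ^ 2 * (1 / ε)) := by
      rw [Finset.sum_add_distrib, ← Finset.mul_sum]
      have h1 := sum_sketchDefect_le (s := s) hU
      have h2 := sum_sketchError_columns_le (s := s) hU hunit horth
      have h3 : (n : ℝ) / s ≤ δ * ε ^ 2 := by
        refine le_trans ?_ hmom
        gcongr
        nlinarith
      calc _ ≤ Fintype.card (CountSketchSeed s m) * (((n : ℝ) ^ 2 + n) / s) +
            (1 / ε - 1) * (Fintype.card (CountSketchSeed s m) * ((n : ℝ) / s)) := by gcongr
        _ ≤ Fintype.card (CountSketchSeed s m) * (δ * ε ^ 2) +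
            (1 / ε - 1) * (Fintype.card (CountSketchSeed s m) * (δ * ε ^ 2)) := by gcongr
        _ = _ := by ring
    refine countSketchLaw_real_ge _ (fun ω => add_nonneg (sketchDefect_nonneg ω U)
      (mul_nonneg ht (Finset.sum_nonneg fun _ _ => sq_nonneg _))) hε0 (E := δ * ε ^ 2 * (1 / ε))
      (by rw [sq]; field_simp; exact le_rfl) hsum _ ?_
    intro ω hω Q R hQR
    have hQR' : IsQR (countSketch ω * (U * J)) Q R := by rwa [hUJ]
    have hdef : √(sketchDefect ω U) < 1 := by
      rw [Real.sqrt_lt' one_pos]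
      have : 0 ≤ (1 / ε - 1) * ∑ a, sketchError ω (Uᵀ a) (unitize r) ^ 2 :=
        mul_nonneg ht (Finset.sum_nonneg fun _ _ => sq_nonneg _)
      linarith
    have hR := isUnit_of_embedding hJ hQR' hdef (embedding_of_sketchDefect hU le_rfl)
    refine ⟨hR, ?_⟩
    have hres : b - (U * J * R⁻¹) *ᵥ (pinv (A * R⁻¹) *ᵥ b) = r := by
      rw [hr, pinv_mulVec_precondition hinj hR b, hUJ, mulVec_mulVec _ A]
    have hmain := lsqr_sketch_residual_le hU hQR' hR hε hk2 hres horth hω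
    rw [hUJ] at hmain
    have hrn : l2norm (A *ᵥ (pinv A *ᵥ b) - b) = l2norm r := by
      simp only [l2norm, hr, WithLp.toLp_sub]
      exact norm_sub_rev _ _
    rw [hrn, mulVec_mulVec]
    refine le_of_sq_le_sq ?_ (mul_nonneg (Real.sqrt_nonneg _) (l2norm_nonneg _))
    -- The factor `2` already suffices; only the sign of the `τ` term matters.
    have h0 : 0 ≤ 4 * τ ^ 2 / (1 - ε) := div_nonneg (by positivity) (by linarith [hε.2])
    rw [mul_pow, Real.sq_sqrt (by linarith)]
    refine hmain.trans (mul_le_mul_of_nonneg_right ?_ (sq_nonneg _))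
    linarith
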